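/- Let $\mathcal H$ be a complex Hilbert space (of finite or infinite dimension) and let $m\ge 1$. Let $Gr_m(\mathcal H)$ be the Grassmann manifold of $m$-dimensional complex subspaces $X\subset\mathcal H$, let $\mathcal P(X)$ be the orthogonal projection onto $X$, and give $Gr_m(\mathcal H)$ the real smooth structure with the coordinate systems $\Gamma_X:\mathrm{Hom}(X,X^\perp)\to Gr_m(\mathcal H)$, $\Gamma_X(f)=\{x+f(x)\mid x\in X\}$; it is the one induced by the embedding $X\mapsto\mathcal P(X)$ in the bounded operators. Differentiating $\Gamma_X$ at $0$ identifies $T_X Gr_m(\mathcal H)$ with $\mathrm{Hom}(X,X^\perp)$; for a smooth function $F$ on $Gr_m(\mathcal H)$ with values in a real normed space, $F'_X(\varphi)$ denotes its differential at $X$ in the direction $\varphi\in\mathrm{Hom}(X,X^\perp)$. Let $C=\{(X,x)\mid X\in Gr_m(\mathcal H),\ x\in X\}\subset Gr_m(\mathcal H)\times\mathcal H$ be the total space of the canonical (tautological) bundle $(X,x)\mapsto X$, with the local trivializations $(f,y)\mapsto(\Gamma_X(f),\,y+f(y))$, $f\in\mathrm{Hom}(X,X^\perp)$, $y\in X$.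 Its tangent spaces are $$T_{(X,x)}C=\{(\varphi,u)\in\mathrm{Hom}(X,X^\perp)\times\mathcal H\mid \varphi(x)=u-\mathcal P(X)u\},$$ and the vertical subspace, i.e. the kernel of the differential of the bundle projection, is $Vert(X,x)=\{(0,u)\mid u\in X\}\cong X$. Then the distribution $$Hor(X,x)=\{(\varphi,\varphi(x))\mid \varphi\in\mathrm{Hom}(X,X^\perp)\}\subset T_{(X,x)}C$$ is a (linear) connection on the canonical bundle: it is complementary to the vertical distribution, $T_{(X,x)}C=Vert(X,x)\oplus Hor(X,x)$; it is smooth, i.e. in each of the above local trivializations, at the point $(f,y)$, it is the graph of a bounded real-linear map from $\mathrm{Hom}(X,X^\perp)$ to $X$ that depends smoothly on $(f,y)$; and it is compatible with the addition and the multiplication by complex scalars in the fibres. Regard the smooth sections of the canonical bundle as the smooth functions $s:Gr_m(\mathcal H)\to\mathcal H$ with $s(X)\in X$ for all $X$. Let $\nabla$ be the covariant derivative corresponding to $Hor$: for a smooth section $s$ and $\varphi\in\mathrm{Hom}(X,X^\perp)\cong T_XGr_m(\mathcal H)$, $\nabla_\varphi s\in X$ is the projection of $(\varphi,s'_X(\varphi))\in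 T_{(X,s(X))}C$ to $Vert(X,s(X))\cong X$ along $Hor(X,s(X))$. Then $\nabla$ is a covariant derivative on the canonical bundle: $\nabla_\varphi s$ is real-linear in $\varphi$ and additive in $s$, it satisfies $\nabla_\varphi(gs)=g'_X(\varphi)\,s(X)+g(X)\,\nabla_\varphi s$ for all smooth $g:Gr_m(\mathcal H)\to\mathbb C$, and $\nabla s$ is a smooth section of the bundle of real-linear maps from $TGr_m(\mathcal H)$ to the canonical bundle. Moreover, for all $s$, $X$ and $\varphi$, $$\nabla_\varphi s=\mathcal P(X)\big(s'_X(\varphi)\big)=s'_X(\varphi)-\varphi(s(X)).$$ -/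

import Mathlib

set_option maxSynthPendingDepth 3

open scoped ContDiff

noncomputable section

namespace GrassmannCanonical

/-- The set `Gr_m(H)` of `m`-dimensional complex subspaces of `H`. -/
@[ext]
structure Gr (H : Type*) [NormedAddCommGroup H] [InnerProductSpace ℂ H] (m : ℕ) where
  carrier : Submodule ℂ H
  finiteDimensional : FiniteDimensional ℂ carrier
  finrank_eq : Module.finrank ℂ carrier = m

variable {H : Type*} [NormedAddCommGroup H] [InnerProductSpace ℂ H] {m : ℕ}

instance (X : Gr H m) : FiniteDimensional ℂ X.carrier := X.finiteDimensional

instance (X : Gr H m) : CompleteSpace X.carrier := FiniteDimensional.complete ℂ X.carrier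

/-- The orthogonal projection of `H` onto `X`, as a bounded operator on `H`. -/
def Gr.proj (X : Gr H m) : H →L[ℂ] H := X.carrier.starProjection

/-- `Hom(X, X^⊥)`, the model of the tangent space of `Gr_m(H)` at `X`: the vector `φ` is the
velocity at `t = 0` of the curve of graphs `t ↦ Γ_X(t φ)`. -/
abbrev Gr.Tangent (X : Gr H m) : Type _ := X.carrier →L[ℂ] X.carrierᗮ

/-- The map `x ↦ x + f x` from `X` to `H`. -/
def Gr.graphMap (X : Gr H m) (f : X.Tangent) : X.carrier →ₗ[ℂ] H where
  toFun x := (x : H) + (f x : H)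
  map_add' x y := by
    simp only [Submodule.coe_add, map_add]
    abel
  map_smul' c x := by simp

theorem Gr.proj_graphMap (X : Gr H m) (f : X.Tangent) (x : X.carrier) :
    X.carrier.orthogonalProjectionOnto (X.graphMap f x) = x := by
  change X.carrier.orthogonalProjectionOnto ((x : H) + (f x : H)) = x
  rw [map_add, Submodule.orthogonalProjectionOnto_mem_subspace_eq_self,
    Submodule.orthogonalProjectionOnto_eq_zero_iff.mpr (f x).2, add_zero]

theorem Gr.graphMap_injective (X : Gr H m) (f : X.Tangent) :
    Function.Injective (X.graphMap f) :=
  Function.LeftInverse.injective (X.proj_graphMap f)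

/-- The coordinate system `Γ_X : Hom(X, X^⊥) → Gr_m(H)` around `X`; `Γ_X(f)` is the graph
`{x + f x | x ∈ X}` of `f`. -/
def Gr.chart (X : Gr H m) (f : X.Tangent) : Gr H m where
  carrier := LinearMap.range (X.graphMap f)
  finiteDimensional := inferInstance
  finrank_eq := by
    rw [LinearMap.finrank_range_of_inj (X.graphMap_injective f), X.finrank_eq]

theorem Gr.chart_zero (X : Gr H m) : X.chart 0 = X := by
  ext x
  change x ∈ LinearMap.range (X.graphMap 0) ↔ x ∈ X.carrier
  constructor
  · rintro ⟨y, rfl⟩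
    simp [Gr.graphMap]
  · intro hx
    exact ⟨⟨x, hx⟩, by simp [Gr.graphMap]⟩

/-- The vector `x + f x` as an element of the subspace `Γ_X(f)`. -/
def Gr.graphPoint (X : Gr H m) (f : X.Tangent) (x : X.carrier) : (X.chart f).carrier :=
  ⟨X.graphMap f x, ⟨x, rfl⟩⟩

section Smooth

variable {E : Type*} [NormedAddCommGroup E] [NormedSpace ℝ E]

/-- A function on `Gr_m(H)` is smooth (in the real sense) when it is smooth in every one of the
coordinate systems `Γ_X`, whose images cover `Gr_m(H)`. -/
def IsSmooth (F : Gr H m → E) : Prop :=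
  ∀ X : Gr H m, ContDiff ℝ ∞ (fun f : X.Tangent => F (X.chart f))

/-- The differential `F'_X : Hom(X, X^⊥) → E` of a function on `Gr_m(H)` at `X`. -/
def differential (F : Gr H m → E) (X : Gr H m) : X.Tangent →L[ℝ] E :=
  fderiv ℝ (fun f : X.Tangent => F (X.chart f)) 0

end Smooth

/-! ### The total space of the canonical bundle -/

/-- The total space of the canonical bundle consists of the pairs `(X, x)` with `x ∈ X`. Its
tangent space at `(X, x)`, a subspace of `T_X Gr_m(H) × H = Hom(X, X^⊥) × H`, is the image of the
differential at `(0, x)` of the local trivialization `(f, y) ↦ (Γ_X(f), y + f y)`, the first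
component being read in the coordinate system `Γ_X`. -/
def totalTangent (X : Gr H m) (x : X.carrier) : Submodule ℝ (X.Tangent × H) :=
  LinearMap.range
    (fderiv ℝ (fun q : X.Tangent × X.carrier => (q.1, (q.2 : H) + (q.1 q.2 : H))) (0, x) :
      X.Tangent × X.carrier →ₗ[ℝ] X.Tangent × H)

theorem hasFDerivAt_trivialization (X : Gr H m) (x : X.carrier) :
    ∃ L : X.Tangent × X.carrier →L[ℝ] X.Tangent × H,
      HasFDerivAt (fun q : X.Tangent × X.carrier => (q.1, (q.2 : H) + (q.1 q.2 : H))) L (0, x) ∧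
      ∀ q, L q = (q.1, (q.2 : H) + (q.1 x : H)) := by
  have hb : IsBoundedBilinearMap ℝ (fun q : X.Tangent × X.carrier => (q.1 q.2 : H)) :=
    { add_left := fun f g y => by simp
      smul_left := fun c f y => by simp
      add_right := fun f y z => by simp
      smul_right := fun c f y => by
        have : f (c • y) = c • f y := by
          simp
        simp [this]
      bound := ⟨1, one_pos, fun f y => by
        simpa using f.le_opNorm y⟩ }
  have hs : HasFDerivAt (fun q : X.Tangent × X.carrier => (q.2 : H))
      ((X.carrier.subtypeL.restrictScalars ℝ).comp
        (ContinuousLinearMap.snd ℝ X.Tangent X.carrier)) (0, x) :=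
    ((X.carrier.subtypeL.restrictScalars ℝ).comp
        (ContinuousLinearMap.snd ℝ X.Tangent X.carrier)).hasFDerivAt
  refine ⟨_, (hasFDerivAt_fst (𝕜 := ℝ)).prodMk (hs.add (hb.hasFDerivAt (0, x))), fun q => ?_⟩
  simp

theorem mem_totalTangent_iff_exists (X : Gr H m) (x : X.carrier) (t : X.Tangent × H) :
    t ∈ totalTangent X x ↔ ∃ y : X.carrier, (y : H) + (t.1 x : H) = t.2 := by
  obtain ⟨L, hL, hq⟩ := hasFDerivAt_trivialization X x
  rw [totalTangent, hL.fderiv]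
  constructor
  · rintro ⟨q, rfl⟩
    exact ⟨q.2, by simp [hq]⟩
  · rintro ⟨y, hy⟩
    exact ⟨(t.1, y), by simp [hq, hy]⟩

/-- The tangent space of the total space is `{(φ, u) | φ(x) = P(X^⊥)(u)}`. -/
theorem mem_totalTangent (X : Gr H m) (x : X.carrier) (t : X.Tangent × H) :
    t ∈ totalTangent X x ↔ (t.1 x : H) = t.2 - X.proj t.2 := by
  rw [mem_totalTangent_iff_exists]
  constructor
  · rintro ⟨y, hy⟩
    have h : X.carrier.orthogonalProjectionOnto t.2 = y := by
      rw [← hy, map_add, Submodule.orthogonalProjectionOnto_mem_subspace_eq_self,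
        Submodule.orthogonalProjectionOnto_eq_zero_iff.mpr (t.1 x).2, add_zero]
    have h' : X.proj t.2 = y := congrArg Subtype.val h
    rw [h', ← hy]
    abel
  · intro h
    exact ⟨X.carrier.orthogonalProjectionOnto t.2, by
      rw [h]
      exact add_sub_cancel _ _⟩

/-- The vertical subspace at `(X, x)`: the kernel of the differential of `(X, x) ↦ X`. -/
def vertical (X : Gr H m) (x : X.carrier) : Submodule ℝ (totalTangent X x) :=
  LinearMap.ker ((LinearMap.fst ℝ X.Tangent H).comp (totalTangent X x).subtype)

/-- The canonical identification of the vertical subspace at `(X, x)` with the fibre `X`, which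
takes `(0, u)` to `u`. -/
def verticalToFibre (X : Gr H m) (x : X.carrier) : vertical X x →ₗ[ℝ] X.carrier where
  toFun t := ⟨t.1.1.2, by
    obtain ⟨y, hy⟩ := (mem_totalTangent_iff_exists X x t.1.1).mp t.1.2
    have h : t.1.1.1 = 0 := t.2
    rw [← hy, h]
    simp⟩
  map_add' _ _ := rfl
  map_smul' _ _ := rfl

/-- The inclusion `T_X Gr_m(H) × H → B(H) × H` of the tangent space of `Gr_m(H) × H`, which is
embedded in `B(H) × H` by `(X, x) ↦ (P(X), x)`. -/
def ambientTangent (X : Gr H m) : X.Tangent × H →L[ℝ] (H →L[ℂ] H) × H :=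
  (differential Gr.proj X).prodMap (ContinuousLinearMap.id ℝ H)

/-- The local trivialization `(f, y) ↦ (Γ_X(f), y + f y)` of the total space around the fibre at
`X`, followed by the embedding in `B(H) × H`. -/
def ambientTrivialization (X : Gr H m) (q : X.Tangent × X.carrier) : (H →L[ℂ] H) × H :=
  ((X.chart q.1).proj, X.graphMap q.1 q.2)

/-- A distribution `D(X, x) ⊆ T_{(X, x)}` on the total space of the canonical bundle is a (linear)
connection when it is complementary to the vertical distribution, smooth, and compatible with the
vector space operations of the fibres. -/
structure IsConnection (D : ∀ X : Gr H m, X.carrier → Submodule ℝ (X.Tangent × H)) : Prop where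
  le_tangent : ∀ X x, D X x ≤ totalTangent X x
  isCompl : ∀ X x, IsCompl (vertical X x) ((D X x).submoduleOf (totalTangent X x))
  /-- In each local trivialization, `D` is the graph of a smooth family `A` of bounded linear maps
  from the tangent space of the base to the fibre. -/
  smooth : ∀ X : Gr H m, ∃ A : X.Tangent × X.carrier → X.Tangent →L[ℝ] X.carrier,
    ContDiff ℝ ∞ A ∧
    ∀ (q : X.Tangent × X.carrier) (φ : X.Tangent) (w : X.carrier),
      fderiv ℝ (ambientTrivialization X) q (φ, w) ∈
        (D (X.chart q.1) (X.graphPoint q.1 q.2)).map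
          (ambientTangent (X.chart q.1) :
            (X.chart q.1).Tangent × H →ₗ[ℝ] (H →L[ℂ] H) × H) ↔
      w = A q φ
  /-- `D` is preserved by the differential `(φ, u) ↦ (φ, c u)` of `(X, x) ↦ (X, c x)`. -/
  smul : ∀ X x (c : ℂ) φ u, (φ, u) ∈ D X x → (φ, c • u) ∈ D X (c • x)
  /-- `D` is preserved by the differential of the fibrewise addition. -/
  add : ∀ X x y φ u v, (φ, u) ∈ D X x → (φ, v) ∈ D X y → (φ, u + v) ∈ D X (x + y)

/-! ### Sections and covariant derivatives -/

variable (H m) in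
/-- The space of smooth sections of the canonical bundle: smooth functions `s : Gr_m(H) → H`
with `s(X) ∈ X` for all `X`. -/
def smoothSections : Submodule ℂ (Gr H m → H) where
  carrier := {s | (∀ X, s X ∈ X.carrier) ∧ IsSmooth s}
  zero_mem' := ⟨fun X => X.carrier.zero_mem, fun _ => contDiff_const⟩
  add_mem' hs ht := ⟨fun X => X.carrier.add_mem (hs.1 X) (ht.1 X), fun X => (hs.2 X).add (ht.2 X)⟩
  smul_mem' c _ hs :=
    ⟨fun X => X.carrier.smul_mem c (hs.1 X), fun X => (hs.2 X).const_smul c⟩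

/-- The value of a section at `X`, as an element of the fibre. -/
def sectionValue (s : smoothSections H m) (X : Gr H m) : X.carrier := ⟨s.1 X, s.2.1 X⟩

/-- The product of a section with a smooth complex-valued function on `Gr_m(H)`. -/
def mulSection (g : Gr H m → ℂ) (hg : IsSmooth g) (s : smoothSections H m) :
    smoothSections H m :=
  ⟨fun X => g X • s.1 X, fun X => X.carrier.smul_mem _ (s.2.1 X),
    fun X => (hg X).smul (s.2.2 X)⟩

/-- `∇`, which takes a smooth section `s` and a tangent vector `φ` at `X` to `∇_φ s ∈ X`, is a
covariant derivative: additive in `s` (and real-linear in `φ`), subject to the Leibniz rule, and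
such that `∇ s` is a smooth section of `Hom(T Gr_m(H), canonical bundle)`. -/
structure IsCovariantDerivative
    (nabla : smoothSections H m → ∀ X : Gr H m, X.Tangent →ₗ[ℝ] X.carrier) : Prop where
  add : ∀ s t X, nabla (s + t) X = nabla s X + nabla t X
  leibniz : ∀ (g : Gr H m → ℂ) (hg : IsSmooth g) s X φ,
    nabla (mulSection g hg s) X φ =
      differential g X φ • sectionValue s X + g X • nabla s X φ
  /-- In the coordinate system `Γ_X`, where the tangent vector `θ` at `Γ_X(f)` has coordinate
  vector `φ`, the family `∇ s` is given by a smooth family `B` of bounded linear maps. -/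
  smooth : ∀ s (X : Gr H m), ∃ B : X.Tangent → X.Tangent →L[ℝ] H, ContDiff ℝ ∞ B ∧
    ∀ (f φ : X.Tangent) (θ : (X.chart f).Tangent),
      fderiv ℝ (fun f : X.Tangent => (X.chart f).proj) f φ =
          differential Gr.proj (X.chart f) θ →
        (nabla s (X.chart f) θ : H) = B f φ

theorem sectionDifferential_mem (s : smoothSections H m) (X : Gr H m) (φ : X.Tangent) :
    (φ, differential s.1 X φ) ∈ totalTangent X (sectionValue s X) := by
  obtain ⟨L, hL, hq⟩ := hasFDerivAt_trivialization X (sectionValue s X)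
  have hs : HasFDerivAt (fun f : X.Tangent => s.1 (X.chart f)) (differential s.1 X) 0 :=
    ((s.2.2 X).differentiable (by simp)).differentiableAt.hasFDerivAt
  let c : X.Tangent → X.carrier := fun f => X.carrier.orthogonalProjectionOnto (s.1 (X.chart f))
  have hc : HasFDerivAt c
      ((X.carrier.orthogonalProjectionOnto.restrictScalars ℝ).comp (differential s.1 X)) 0 :=
    (X.carrier.orthogonalProjectionOnto.restrictScalars ℝ).hasFDerivAt.comp 0 hs
  have hc0 : c 0 = sectionValue s X := by
    change X.carrier.orthogonalProjectionOnto (s.1 (X.chart 0)) = _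
    rw [X.chart_zero]
    exact Submodule.orthogonalProjectionOnto_mem_subspace_eq_self (sectionValue s X)
  have hpt : ∀ f : X.Tangent, (c f : H) + (f (c f) : H) = s.1 (X.chart f) := by
    intro f
    obtain ⟨y, hy⟩ := s.2.1 (X.chart f)
    have hy' : c f = y := by
      change X.carrier.orthogonalProjectionOnto (s.1 (X.chart f)) = y
      rw [← hy, X.proj_graphMap]
    rw [hy']
    exact hy
  rw [← hc0] at hL
  have h1 := hL.comp (0 : X.Tangent) ((hasFDerivAt_id (𝕜 := ℝ) (0 : X.Tangent)).prodMk hc)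
  have h2 := h1.unique (((hasFDerivAt_id (𝕜 := ℝ) (0 : X.Tangent)).prodMk hs).congr_of_eventuallyEq
    (Filter.Eventually.of_forall fun f => Prod.ext rfl (hpt f)))
  have h3 := congrArg Prod.snd (DFunLike.congr_fun h2 φ)
  rw [ContinuousLinearMap.comp_apply, hq] at h3
  exact (mem_totalTangent_iff_exists X _ _).mpr ⟨_, h3⟩

/-- The differential `φ ↦ (φ, s'_X(φ))` at `X` of a section, regarded as the map `X ↦ (X, s(X))`
to the total space. -/
def sectionDifferential (s : smoothSections H m) (X : Gr H m) :
    X.Tangent →ₗ[ℝ] totalTangent X (sectionValue s X) :=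
  LinearMap.codRestrict (totalTangent X (sectionValue s X))
    (LinearMap.prod LinearMap.id (differential s.1 X : X.Tangent →ₗ[ℝ] H)) 
    (sectionDifferential_mem s X)

/-- The covariant derivative of a connection: `∇_φ s` is the projection of the differential of `s`
in the direction `φ` to the vertical subspace along `D`, the vertical subspace being identified
with the fibre. -/
def IsConnection.covariantDerivative
    {D : ∀ X : Gr H m, X.carrier → Submodule ℝ (X.Tangent × H)} (hD : IsConnection D)
    (s : smoothSections H m) (X : Gr H m) : X.Tangent →ₗ[ℝ] X.carrier :=
  (verticalToFibre X (sectionValue s X)).comp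
    ((Submodule.projectionOnto (vertical X (sectionValue s X))
      ((D X (sectionValue s X)).submoduleOf (totalTangent X (sectionValue s X)))
      (hD.isCompl X (sectionValue s X))).comp
      (sectionDifferential s X))

/-- The distribution `Hor(X, x) = {(φ, φ(x)) | φ ∈ Hom(X, X^⊥)}`. -/
def horizontal (X : Gr H m) (x : X.carrier) : Submodule ℝ (X.Tangent × H) where
  carrier := Set.range fun φ : X.Tangent => (φ, (φ x : H))
  zero_mem' := ⟨0, by simp⟩
  add_mem' := by
    rintro _ _ ⟨φ, rfl⟩ ⟨ψ, rfl⟩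
    exact ⟨φ + ψ, by simp⟩
  smul_mem' := by
    rintro c _ ⟨φ, rfl⟩
    exact ⟨c • φ, by simp⟩

end GrassmannCanonical

end

open Filter Topology
noncomputable section

namespace GrassmannCanonical

/-! ### Real smoothness of operations on complex-linear operators -/

section ComplexOperators

variable {V E F G : Type*} [NormedAddCommGroup V] [NormedSpace ℝ V]
  [NormedAddCommGroup E] [NormedSpace ℂ E] [NormedAddCommGroup F] [NormedSpace ℂ F]
  [NormedAddCommGroup G] [NormedSpace ℂ G]

/-! The algebra is pointwise. A tangent vector (φ, u) at (X, x) satisfies u = P(X)u + φ(x), so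
subtracting the horizontal vector (φ, φ(x)) leaves a vertical one. For (φ, s'_X(φ)) this leaves
s'_X(φ) - φ(s(X)), which tangency identifies with P(X)(s'_X(φ)) (`covariantDerivative_eq`,
`differential_eq_proj_add`).

The work lies in smoothness. With G the graph operator x ↦ x + f x, `Gr.proj_chart` gives P(Γ_X(f))
= G(G*G)⁻¹G*, which is smooth in f. Differentiating P(Γ_X(f))(y + f y) = y + f y in the direction φ
yields φ y - P(φ y) (`Gr.fderiv_proj_graphOp`). Comparison with the differential of the
trivialization shows that (φ, w) is horizontal exactly when w + f w = -P(φ y), so w is the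
X-component of -P(φ y).

Tangent vectors in different charts are compared through P: `Gr.coord` recovers f smoothly from
P(Γ_X(f)), so the chain rule carries differentials from one chart to another (`fderiv_chart_eq`). -/

theorem contDiffAt_comp_complex {n : WithTop ℕ∞} {a : V → F →L[ℂ] G} {b : V → E →L[ℂ] F} {v : V}
    (ha : ContDiffAt ℝ n a v) (hb : ContDiffAt ℝ n b v) :
    ContDiffAt ℝ n (fun x => (a x).comp (b x)) v := by
  have h : ContDiff ℝ n (fun p : (F →L[ℂ] G) × (E →L[ℂ] F) => p.1.comp p.2) :=
    (isBoundedBilinearMap_comp (𝕜 := ℂ)).contDiff.restrict_scalars ℝ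
  exact h.contDiffAt.comp v (ha.prodMk hb)

theorem contDiffAt_inverse_complex [CompleteSpace E] {n : WithTop ℕ∞} {a : V → E →L[ℂ] E} {v : V}
    (ha : ContDiffAt ℝ n a v) (hu : IsUnit (a v)) :
    ContDiffAt ℝ n (fun x => Ring.inverse (a x)) v := by
  obtain ⟨u, hu⟩ := hu
  have h : ContDiffAt ℝ n (Ring.inverse : (E →L[ℂ] E) → E →L[ℂ] E) (a v) := by
    rw [← hu]
    exact (contDiffAt_ringInverse ℂ u).restrict_scalars ℝ
  exact h.comp v ha

/-- Conjugate-linear maps are real-linear, so additivity and continuity of the adjoint suffice. -/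
theorem contDiff_adjoint {E F : Type*} [NormedAddCommGroup E] [InnerProductSpace ℂ E]
    [NormedAddCommGroup F] [InnerProductSpace ℂ F] [CompleteSpace E] [CompleteSpace F]
    {n : WithTop ℕ∞} :
    ContDiff ℝ n (fun T : E →L[ℂ] F => ContinuousLinearMap.adjoint T) :=
  (AddMonoidHom.toRealLinearMap
    ((ContinuousLinearMap.adjoint : (E →L[ℂ] F) ≃ₗᵢ⋆[ℂ] (F →L[ℂ] E)) :
      (E →L[ℂ] F) →+ (F →L[ℂ] E))
    (ContinuousLinearMap.adjoint : (E →L[ℂ] F) ≃ₗᵢ⋆[ℂ] (F →L[ℂ] E)).continuous).contDiff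

theorem isUnit_of_injective [FiniteDimensional ℂ E] {T : E →L[ℂ] E}
    (hT : Function.Injective T) : IsUnit T := by
  have : CompleteSpace E := FiniteDimensional.complete ℂ E
  rw [ContinuousLinearMap.isUnit_iff_bijective]
  exact ⟨hT, LinearMap.surjective_of_injective (f := (T : E →ₗ[ℂ] E)) hT⟩

end ComplexOperators

variable {H : Type*} [NormedAddCommGroup H] [InnerProductSpace ℂ H] {m : ℕ}

/-! ### The projections onto graphs -/

/-- The map `x ↦ x + f x` as a bounded operator. -/
def Gr.graphOp (X : Gr H m) (f : X.Tangent) : X.carrier →L[ℂ] H :=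
  X.carrier.subtypeL + X.carrierᗮ.subtypeL.comp f

theorem Gr.graphOp_apply (X : Gr H m) (f : X.Tangent) (x : X.carrier) :
    X.graphOp f x = (x : H) + (f x : H) := rfl

theorem Gr.graphOp_mem (X : Gr H m) (f : X.Tangent) (x : X.carrier) :
    X.graphOp f x ∈ (X.chart f).carrier := ⟨x, rfl⟩

theorem Gr.mem_chart (X : Gr H m) (f : X.Tangent) {v : H} :
    v ∈ (X.chart f).carrier ↔ ∃ x, X.graphOp f x = v := Iff.rfl

theorem Gr.proj_graphOp (X : Gr H m) (f : X.Tangent) (x : X.carrier) :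
    X.carrier.orthogonalProjectionOnto (X.graphOp f x) = x := X.proj_graphMap f x

theorem Gr.orthProj_graphOp (X : Gr H m) (f : X.Tangent) (x : X.carrier) :
    X.carrierᗮ.orthogonalProjectionOnto (X.graphOp f x) = f x := by
  rw [X.graphOp_apply, map_add, Submodule.orthogonalProjectionOnto_mem_subspace_eq_self,
    Submodule.orthogonalProjectionOnto_eq_zero_iff.mpr
      (X.carrier.le_orthogonal_orthogonal x.2), zero_add]

theorem Gr.proj_apply_mem (X : Gr H m) (v : H) : X.proj v ∈ X.carrier :=
  Submodule.starProjection_apply_mem _ _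

theorem Gr.proj_of_mem (X : Gr H m) {v : H} (hv : v ∈ X.carrier) : X.proj v = v :=
  Submodule.starProjection_eq_self_iff.mpr hv

theorem Gr.proj_of_mem_orthogonal (X : Gr H m) {v : H} (hv : v ∈ X.carrierᗮ) : X.proj v = 0 :=
  (Submodule.starProjection_apply_eq_zero_iff _).mpr hv

theorem Gr.contDiff_graphOp (X : Gr H m) {n : WithTop ℕ∞} : ContDiff ℝ n X.graphOp := by
  have h : ContDiff ℝ n (fun f : X.Tangent => X.carrierᗮ.subtypeL.comp f) :=
    contDiff_iff_contDiffAt.mpr fun f => contDiffAt_comp_complex contDiffAt_const contDiffAt_id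
  exact contDiff_const.add h

/-- Since ⟨G*G x, x⟩ = ‖G x‖² and G is injective, G*G is injective on a finite-dimensional space. -/
theorem Gr.isUnit_gram [CompleteSpace H] (X : Gr H m) (f : X.Tangent) :
    IsUnit ((ContinuousLinearMap.adjoint (X.graphOp f)).comp (X.graphOp f)) := by
  refine isUnit_of_injective ((injective_iff_map_eq_zero _).mpr fun x hx => ?_)
  have h : inner ℂ (X.graphOp f x) (X.graphOp f x) = (0 : ℂ) := by
    rw [← ContinuousLinearMap.adjoint_inner_left, ← ContinuousLinearMap.comp_apply, hx,
      inner_zero_left]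
  have h0 := inner_self_eq_zero.mp h
  rw [← X.proj_graphOp f x, h0, map_zero]

/-- The normal equations: the right-hand side takes values in the range of G, and G* annihilates the
remainder. -/
theorem Gr.proj_chart [CompleteSpace H] (X : Gr H m) (f : X.Tangent) :
    (X.chart f).proj = (X.graphOp f).comp
      ((Ring.inverse ((ContinuousLinearMap.adjoint (X.graphOp f)).comp (X.graphOp f))).comp
        (ContinuousLinearMap.adjoint (X.graphOp f))) := by
  ext v
  refine Submodule.eq_starProjection_of_mem_of_inner_eq_zero (X.graphOp_mem f _) ?_
  rintro _ ⟨y, rfl⟩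
  change inner ℂ _ (X.graphOp f y) = (0 : ℂ)
  rw [← ContinuousLinearMap.adjoint_inner_left, map_sub, inner_sub_left, sub_eq_zero]
  congr 1
  have h := Ring.mul_inverse_cancel _ (X.isUnit_gram f)
  exact (DFunLike.congr_fun h (ContinuousLinearMap.adjoint (X.graphOp f) v)).symm

/-- The embedding `X ↦ P(X)` in the bounded operators is smooth. -/
theorem isSmooth_proj [CompleteSpace H] :
    IsSmooth (Gr.proj : Gr H m → H →L[ℂ] H) := by
  intro X
  simp only [X.proj_chart]
  refine contDiff_iff_contDiffAt.mpr fun f => ?_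
  have hG : ContDiffAt ℝ ∞ X.graphOp f := X.contDiff_graphOp.contDiffAt
  have hA : ContDiffAt ℝ ∞ (fun f => ContinuousLinearMap.adjoint (X.graphOp f)) f :=
    contDiff_adjoint.contDiffAt.comp f hG
  exact contDiffAt_comp_complex hG (contDiffAt_comp_complex
    (contDiffAt_inverse_complex (contDiffAt_comp_complex hA hG) (X.isUnit_gram f)) hA)

/-! ### Change of coordinates -/

/-- The compression of an operator on `H` to `X`. -/
def Gr.compression (X : Gr H m) (T : H →L[ℂ] H) : X.carrier →L[ℂ] X.carrier :=
  X.carrier.orthogonalProjectionOnto.comp (T.comp X.carrier.subtypeL)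

/-- The coordinates in the coordinate system `Γ_X`, in terms of the projection. -/
def Gr.coord (X : Gr H m) (T : H →L[ℂ] H) : X.Tangent :=
  (X.carrierᗮ.orthogonalProjectionOnto.comp (T.comp X.carrier.subtypeL)).comp
    (Ring.inverse (X.compression T))

theorem Gr.contDiff_compression (X : Gr H m) : ContDiff ℝ ∞ X.compression :=
  contDiff_iff_contDiffAt.mpr fun _ => contDiffAt_comp_complex contDiffAt_const
    (contDiffAt_comp_complex contDiffAt_id contDiffAt_const)

theorem Gr.contDiffAt_coord (X : Gr H m) {T : H →L[ℂ] H} (hT : IsUnit (X.compression T)) :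
    ContDiffAt ℝ ∞ X.coord T :=
  contDiffAt_comp_complex
    (contDiffAt_comp_complex contDiffAt_const
      (contDiffAt_comp_complex contDiffAt_id contDiffAt_const))
    (contDiffAt_inverse_complex X.contDiff_compression.contDiffAt hT)

/-- If x is in the kernel, the projection of x to the graph has zero X-component, hence vanishes.
Then x is orthogonal to x + f x, whose inner product with x is ‖x‖². -/
theorem Gr.isUnit_compression_chart (X : Gr H m) (f : X.Tangent) :
    IsUnit (X.compression (X.chart f).proj) := by
  refine isUnit_of_injective ((injective_iff_map_eq_zero _).mpr fun x hx => ?_)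
  obtain ⟨z, hz⟩ := (X.mem_chart f).mp ((X.chart f).proj_apply_mem x)
  have hz0 : z = 0 := by
    rw [← X.proj_graphOp f z, hz]
    exact hx
  rw [hz0, map_zero] at hz
  have hx' : (x : H) ∈ (X.chart f).carrierᗮ :=
    (Submodule.starProjection_apply_eq_zero_iff _).mp hz.symm
  have h := Submodule.inner_right_of_mem_orthogonal (X.graphOp_mem f x) hx'
  rw [X.graphOp_apply, inner_add_left,
    Submodule.inner_left_of_mem_orthogonal x.2 (f x).2, add_zero] at h
  exact Subtype.ext (inner_self_eq_zero.mp h)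

/-- Values of P(Γ_X(f)) lie on the graph, so their X^⊥-component is f of their X-component; cancel
the compression. -/
theorem Gr.coord_chart (X : Gr H m) (f : X.Tangent) : X.coord (X.chart f).proj = f := by
  have h : X.carrierᗮ.orthogonalProjectionOnto.comp
      ((X.chart f).proj.comp X.carrier.subtypeL) = f.comp (X.compression (X.chart f).proj) := by
    ext x
    obtain ⟨z, hz⟩ := (X.mem_chart f).mp ((X.chart f).proj_apply_mem x)
    change (X.carrierᗮ.orthogonalProjectionOnto ((X.chart f).proj x) : H) =
      f (X.carrier.orthogonalProjectionOnto ((X.chart f).proj x))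
    rw [← hz, X.orthProj_graphOp, X.proj_graphOp]
  have h' := Ring.mul_inverse_cancel _ (X.isUnit_compression_chart f)
  rw [Gr.coord, h, ContinuousLinearMap.comp_assoc]
  exact (congrArg f.comp h').trans f.comp_id

/-- For x in X, the vector P(W)T⁻¹x, with T the compression, has X-component x and lies on the
graph. Thus the graph is contained in W, and the dimensions agree. -/
theorem Gr.chart_coord (X W : Gr H m) (hW : IsUnit (X.compression W.proj)) :
    X.chart (X.coord W.proj) = W := by
  apply Gr.ext
  refine Submodule.eq_of_le_of_finrank_eq ?_ ((X.chart _).finrank_eq.trans W.finrank_eq.symm)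
  rintro _ ⟨x, rfl⟩
  have h := DFunLike.congr_fun (Ring.mul_inverse_cancel _ hW) x
  have h' : X.carrier.orthogonalProjectionOnto
      (W.proj (Ring.inverse (X.compression W.proj) x)) = x := h
  have key : X.graphMap (X.coord W.proj) x = W.proj (Ring.inverse (X.compression W.proj) x) := by
    have h2 := X.carrier.starProjection_add_starProjection_orthogonal
      (W.proj (Ring.inverse (X.compression W.proj) x))
    rw [← h2]
    exact congrArg₂ (· + ·) (congrArg Subtype.val h').symm rfl
  rw [key]
  exact W.proj_apply_mem _

variable {E : Type*} [NormedAddCommGroup E] [NormedSpace ℝ E]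

theorem IsSmooth.differentiable {F : Gr H m → E} (hF : IsSmooth F) (X : Gr H m) :
    Differentiable ℝ (fun f : X.Tangent => F (X.chart f)) :=
  (hF X).differentiable (by simp)

theorem Gr.differentiableAt_coord (X : Gr H m) (f : X.Tangent) :
    DifferentiableAt ℝ X.coord (X.chart f).proj :=
  (X.contDiffAt_coord (X.isUnit_compression_chart f)).differentiableAt (by simp)

/-- The coordinate change from `Γ_Y` to `Γ_X` transforms differentials by the differential of
`X.coord`. -/
theorem fderiv_chart_eq [CompleteSpace H] {F : Gr H m → E} (hF : IsSmooth F) {X Y : Gr H m} {f : X.Tangent}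
    {g : Y.Tangent} (h : X.chart f = Y.chart g) (θ : Y.Tangent) :
    fderiv ℝ (fun g => F (Y.chart g)) g θ = fderiv ℝ (fun f => F (X.chart f)) f
      (fderiv ℝ X.coord (X.chart f).proj (fderiv ℝ (fun g => (Y.chart g).proj) g θ)) := by
  have hP : DifferentiableAt ℝ (fun g => (Y.chart g).proj) g := isSmooth_proj.differentiable Y g
  have hc : DifferentiableAt ℝ X.coord (Y.chart g).proj := h ▸ X.differentiableAt_coord f
  have hcg : X.coord (Y.chart g).proj = f := h ▸ X.coord_chart f
  have hu : IsUnit (X.compression (Y.chart g).proj) := h ▸ X.isUnit_compression_chart f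
  have hcont : ContinuousAt (fun g => X.compression (Y.chart g).proj) g :=
    (X.contDiff_compression.continuous.comp (isSmooth_proj Y).continuous).continuousAt
  -- The factorization through Γ_X is only local: it needs an invertible compression, which is an
  -- open condition.
  have hev : (fun g' => F (Y.chart g')) =ᶠ[𝓝 g]
      (fun f => F (X.chart f)) ∘ X.coord ∘ fun g' => (Y.chart g').proj := by
    filter_upwards [hcont.eventually (Units.isOpen.mem_nhds hu)] with g' hg'
    exact congrArg F (X.chart_coord _ hg').symm
  have hFd : HasFDerivAt (fun f => F (X.chart f)) (fderiv ℝ (fun f => F (X.chart f)) f)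
      (X.coord (Y.chart g).proj) := by
    rw [hcg]
    exact (hF.differentiable X f).hasFDerivAt
  have hcomp := (hFd.comp g (hc.hasFDerivAt.comp g hP.hasFDerivAt)).congr_of_eventuallyEq hev
  rw [hcomp.fderiv, h]
  rfl

theorem Gr.fderiv_coord_fderiv_chart [CompleteSpace H] (X : Gr H m) (f φ : X.Tangent) :
    fderiv ℝ X.coord (X.chart f).proj (fderiv ℝ (fun f => (X.chart f).proj) f φ) = φ := by
  have h := (X.differentiableAt_coord f).hasFDerivAt.comp f
    (isSmooth_proj.differentiable X f).hasFDerivAt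
  have h' := h.unique ((hasFDerivAt_id (𝕜 := ℝ) f).congr_of_eventuallyEq
    (Eventually.of_forall X.coord_chart))
  exact DFunLike.congr_fun h' φ

/-- The hypothesis says that φ and θ represent one tangent vector; the derivative of `X.coord` turns
the common image in B(H) back into φ. -/
theorem fderiv_chart_eq_differential [CompleteSpace H] {F : Gr H m → E} (hF : IsSmooth F) {X : Gr H m}
    {f φ : X.Tangent} {θ : (X.chart f).Tangent}
    (h : fderiv ℝ (fun f : X.Tangent => (X.chart f).proj) f φ =
      differential Gr.proj (X.chart f) θ) :
    differential F (X.chart f) θ = fderiv ℝ (fun f => F (X.chart f)) f φ := by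
  have h1 := fderiv_chart_eq hF (X.chart f).chart_zero.symm θ
  rw [differential, h1]
  rw [differential] at h
  rw [← h, X.fderiv_coord_fderiv_chart]

/-- The coordinate change applied to P itself, from Γ_X at f to the chart centred at Γ_X(f). -/
theorem exists_differential_proj_eq [CompleteSpace H] (X : Gr H m) (f φ : X.Tangent) :
    ∃ θ : (X.chart f).Tangent, differential Gr.proj (X.chart f) θ =
      fderiv ℝ (fun f : X.Tangent => (X.chart f).proj) f φ := by
  have h := fderiv_chart_eq isSmooth_proj (X.chart f).chart_zero φ
  exact ⟨_, h.symm⟩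

/-- The derivative of the identity `P(Γ_X(f)) (y + f y) = y + f y` with respect to `f`. -/
theorem Gr.fderiv_proj_graphOp [CompleteSpace H] (X : Gr H m) (f φ : X.Tangent) (y : X.carrier) :
    fderiv ℝ (fun f : X.Tangent => (X.chart f).proj) f φ (X.graphOp f y) =
      (φ y : H) - (X.chart f).proj (φ y : H) := by
  obtain ⟨L, hL, hLq⟩ := hasFDerivAt_trivialization X y
  have hb : IsBoundedBilinearMap ℝ (fun p : (H →L[ℂ] H) × H => p.1 p.2) :=
    { add_left := fun _ _ _ => rfl
      smul_left := fun _ _ _ => rfl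
      add_right := fun a _ _ => map_add a _ _
      smul_right := fun c a v => (a.restrictScalars ℝ).map_smul c v
      bound := ⟨1, one_pos, fun a v => by simpa using a.le_opNorm v⟩ }
  let ev : X.Tangent →L[ℝ] H := (X.carrierᗮ.subtypeL.restrictScalars ℝ).comp
    ((ContinuousLinearMap.apply ℂ X.carrierᗮ y).restrictScalars ℝ)
  have hG : HasFDerivAt (fun f => X.graphOp f y) ev f := by
    have h : HasFDerivAt (fun f => (y : H) + ev f) ev f := ev.hasFDerivAt.const_add (y : H)
    exact h
  have hP := (isSmooth_proj.differentiable X f).hasFDerivAt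
  have h1 := (hb.hasFDerivAt ((X.chart f).proj, X.graphOp f y)).comp f (hP.prodMk hG)
  have h2 := h1.unique (hG.congr_of_eventuallyEq
    (Eventually.of_forall fun f' => (X.chart f').proj_of_mem (X.graphOp_mem f' y)))
  have h3 := DFunLike.congr_fun h2 φ
  have h4 : (X.chart f).proj (φ y : H) +
    fderiv ℝ (fun f : X.Tangent => (X.chart f).proj) f φ (X.graphOp f y) = (φ y : H) := h3
  exact eq_sub_of_add_eq' h4

/-- The case f = 0 of the previous identity, where P(Y) kills θ x. It lets θ be read off from its
image in B(H). -/
theorem Gr.differential_proj_apply [CompleteSpace H] (Y : Gr H m) (θ : Y.Tangent) (x : Y.carrier) :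
    differential Gr.proj Y θ x = θ x := by
  have h := Y.fderiv_proj_graphOp 0 θ x
  rw [Y.chart_zero, Y.proj_of_mem_orthogonal (θ x).2, sub_zero] at h
  have h0 : Y.graphOp 0 x = x := by simp [Gr.graphOp_apply]
  rwa [h0] at h

/-! ### The connection -/

theorem mem_horizontal (X : Gr H m) (x : X.carrier) (φ : X.Tangent) (u : H) :
    (φ, u) ∈ horizontal X x ↔ u = φ x := by
  constructor
  · rintro ⟨ψ, h⟩
    obtain ⟨rfl, rfl⟩ := Prod.mk.inj h
    rfl
  · rintro rfl
    exact ⟨φ, rfl⟩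


theorem horizontal_le_totalTangent (X : Gr H m) (x : X.carrier) :
    horizontal X x ≤ totalTangent X x := by
  rintro ⟨φ, u⟩ h
  rw [mem_horizontal] at h
  exact (mem_totalTangent_iff_exists X x _).mpr ⟨0, by simp [h]⟩

theorem isCompl_vertical_horizontal (X : Gr H m) (x : X.carrier) :
    IsCompl (vertical X x) ((horizontal X x).submoduleOf (totalTangent X x)) := by
  rw [isCompl_iff, Submodule.disjoint_def, codisjoint_iff, Submodule.eq_top_iff']
  constructor
  · rintro ⟨⟨φ, u⟩, ht⟩ (hv : φ = 0) (hh : (φ, u) ∈ horizontal X x)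
    rw [mem_horizontal] at hh
    subst hv
    exact Subtype.ext (Prod.ext rfl (by simpa using hh))
  · rintro ⟨⟨φ, u⟩, ht⟩
    have hh : (φ, (φ x : H)) ∈ horizontal X x := (mem_horizontal X x φ _).mpr rfl
    let h : totalTangent X x := ⟨_, horizontal_le_totalTangent X x hh⟩
    refine Submodule.mem_sup.mpr ⟨⟨(φ, u), ht⟩ - h, sub_self φ, h, hh, sub_add_cancel _ _⟩

/-- The family of bounded linear maps whose graphs are the horizontal subspaces in the local
trivialization around the fibre at `X`. -/
def Gr.connectionForm (X : Gr H m) (q : X.Tangent × X.carrier) : X.Tangent →L[ℂ] X.carrier :=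
  (-X.carrier.orthogonalProjectionOnto).comp ((X.chart q.1).proj.comp
    (X.carrierᗮ.subtypeL.comp (ContinuousLinearMap.apply ℂ X.carrierᗮ q.2)))

theorem Gr.contDiff_connectionForm [CompleteSpace H] (X : Gr H m) :
    ContDiff ℝ ∞ (fun q => (X.connectionForm q).restrictScalars ℝ) := by
  have hP : ContDiff ℝ ∞ (fun q : X.Tangent × X.carrier => (X.chart q.1).proj) :=
    (isSmooth_proj X).comp contDiff_fst
  have hev : ContDiff ℝ ∞
      (fun q : X.Tangent × X.carrier => ContinuousLinearMap.apply ℂ X.carrierᗮ q.2) :=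
    ((ContinuousLinearMap.apply ℂ X.carrierᗮ).restrictScalars ℝ).contDiff.comp contDiff_snd
  have h : ContDiff ℝ ∞ X.connectionForm := contDiff_iff_contDiffAt.mpr fun q =>
    contDiffAt_comp_complex contDiffAt_const (contDiffAt_comp_complex hP.contDiffAt
      (contDiffAt_comp_complex contDiffAt_const hev.contDiffAt))
  exact (ContinuousLinearMap.restrictScalarsL ℂ X.Tangent X.carrier ℝ ℝ).contDiff.comp h

theorem fderiv_ambientTrivialization [CompleteSpace H] (X : Gr H m) (q : X.Tangent × X.carrier)
    (φ : X.Tangent) (w : X.carrier) :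
    fderiv ℝ (ambientTrivialization X) q (φ, w) =
      (fderiv ℝ (fun f : X.Tangent => (X.chart f).proj) q.1 φ, X.graphOp q.1 w + (φ q.2 : H)) := by
  have hb : IsBoundedBilinearMap ℝ (fun q : X.Tangent × X.carrier => q.1 q.2) :=
    { add_left := fun _ _ _ => rfl
      smul_left := fun _ _ _ => rfl
      add_right := fun f y z => map_add f y z
      smul_right := fun c f y => (f.restrictScalars ℝ).map_smul c y
      bound := ⟨1, one_pos, fun f y => by simpa using f.le_opNorm y⟩ }
  have h1 := (isSmooth_proj.differentiable X q.1).hasFDerivAt.comp q (hasFDerivAt_fst (p := q))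
  have h2 := (X.carrier.subtypeL.restrictScalars ℝ).hasFDerivAt.comp q (hasFDerivAt_snd (p := q))
  have h3 := (X.carrierᗮ.subtypeL.restrictScalars ℝ).hasFDerivAt.comp q (hb.hasFDerivAt q)
  have h : HasFDerivAt (ambientTrivialization X) _ q := h1.prodMk (h2.add h3)
  rw [h.fderiv]
  refine Prod.ext rfl ?_
  change (w : H) + ((q.1 w + φ q.2 : X.carrierᗮ) : H) = ((w : H) + (q.1 w : H)) + (φ q.2 : H)
  rw [Submodule.coe_add, add_assoc]

theorem fderiv_ambientTrivialization_mem_iff [CompleteSpace H] (X : Gr H m)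
    (q : X.Tangent × X.carrier) (φ : X.Tangent) (w : X.carrier) :
    fderiv ℝ (ambientTrivialization X) q (φ, w) ∈
      (horizontal (X.chart q.1) (X.graphPoint q.1 q.2)).map
        (ambientTangent (X.chart q.1) :
          (X.chart q.1).Tangent × H →ₗ[ℝ] (H →L[ℂ] H) × H) ↔
      w = X.connectionForm q φ := by
  -- The horizontal lift of θ at y + f y has second component θ(y + f y), expressed here through φ
  -- alone.
  have hval : ∀ θ : (X.chart q.1).Tangent, differential Gr.proj (X.chart q.1) θ =
      fderiv ℝ (fun f : X.Tangent => (X.chart f).proj) q.1 φ →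
      (θ (X.graphPoint q.1 q.2) : H) = (φ q.2 : H) - (X.chart q.1).proj (φ q.2 : H) := by
    intro θ hθ
    rw [← Gr.differential_proj_apply, hθ]
    exact X.fderiv_proj_graphOp q.1 φ q.2
  have hiff : X.graphOp q.1 w + (φ q.2 : H) = (φ q.2 : H) - (X.chart q.1).proj (φ q.2 : H) ↔
      w = X.connectionForm q φ := by
    obtain ⟨z, hz⟩ := (X.mem_chart q.1).mp ((X.chart q.1).proj_apply_mem (φ q.2))
    have hA : X.connectionForm q φ = -z := by
      change -X.carrier.orthogonalProjectionOnto ((X.chart q.1).proj (φ q.2)) = -z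
      rw [← hz, X.proj_graphOp]
    -- Both w + f w and -P(φ y) lie on the graph, so they agree as soon as their X-components do.
    rw [hA, ← hz, add_comm, sub_eq_add_neg, add_right_inj, ← map_neg]
    exact (X.graphMap_injective q.1).eq_iff
  rw [fderiv_ambientTrivialization, ← hiff, Submodule.mem_map]
  constructor
  · rintro ⟨⟨θ, u⟩, hu, h⟩
    obtain ⟨h1, h2⟩ := Prod.mk.inj h
    rw [mem_horizontal] at hu
    rw [← hval θ h1, ← hu]
    exact h2.symm
  · intro h
    obtain ⟨θ, hθ⟩ := exists_differential_proj_eq X q.1 φ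
    refine ⟨(θ, _), (mem_horizontal _ _ _ _).mpr rfl, Prod.ext hθ ?_⟩
    rw [h]
    exact hval θ hθ

theorem isConnection_horizontal [CompleteSpace H] :
    IsConnection (horizontal : ∀ X : Gr H m, X.carrier → Submodule ℝ (X.Tangent × H)) where
  le_tangent := horizontal_le_totalTangent
  isCompl := isCompl_vertical_horizontal
  smooth X := ⟨_, X.contDiff_connectionForm, fderiv_ambientTrivialization_mem_iff X⟩
  smul X x c φ u h := by
    rw [mem_horizontal] at h ⊢
    simp [h]
  add X x y φ u v hu hv := by
    rw [mem_horizontal] at hu hv ⊢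
    simp [hu, hv]

/-! ### The covariant derivative -/

theorem differential_eq_proj_add (s : smoothSections H m) (X : Gr H m) (φ : X.Tangent) :
    X.proj (differential s.1 X φ) = differential s.1 X φ - (φ (sectionValue s X) : H) := by
  rw [(mem_totalTangent X _ _).mp (sectionDifferential_mem s X φ)]
  exact (sub_sub_cancel _ _).symm

theorem covariantDerivative_eq (hor : IsConnection
      (horizontal : ∀ X : Gr H m, X.carrier → Submodule ℝ (X.Tangent × H)))
    (s : smoothSections H m) (X : Gr H m) (φ : X.Tangent) :
    (hor.covariantDerivative s X φ : H) =
      differential s.1 X φ - (φ (sectionValue s X) : H) := by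
  have hh := (mem_horizontal X (sectionValue s X) φ _).mpr rfl
  let h : totalTangent X (sectionValue s X) := ⟨_, horizontal_le_totalTangent X _ hh⟩
  have hmem : h ∈ (horizontal X (sectionValue s X)).submoduleOf (totalTangent X _) := hh
  let v : vertical X (sectionValue s X) := ⟨sectionDifferential s X φ - h, sub_self φ⟩
  have hp : Submodule.projectionOnto _ _ (hor.isCompl X (sectionValue s X))
      (sectionDifferential s X φ) = v := by
    have hsum : sectionDifferential s X φ = v + h := (sub_add_cancel _ _).symm
    rw [hsum, map_add, Submodule.projectionOnto_apply_left,
      Submodule.projectionOnto_apply_of_mem_right _ hmem, add_zero]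
  change ((verticalToFibre X _ (Submodule.projectionOnto _ _ (hor.isCompl X (sectionValue s X))
      (sectionDifferential s X φ)) : X.carrier) : H) = _
  rw [hp]
  rfl

theorem isCovariantDerivative_horizontal [CompleteSpace H] (hor : IsConnection
      (horizontal : ∀ X : Gr H m, X.carrier → Submodule ℝ (X.Tangent × H))) :
    IsCovariantDerivative hor.covariantDerivative where
  add s t X := by
    ext φ
    have hd : differential (s + t).1 X φ = differential s.1 X φ + differential t.1 X φ :=
      DFunLike.congr_fun (fderiv_fun_add (s.2.2.differentiable X 0) (t.2.2.differentiable X 0)) φ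
    have hv : sectionValue (s + t) X = sectionValue s X + sectionValue t X := rfl
    rw [LinearMap.add_apply, Submodule.coe_add, covariantDerivative_eq, covariantDerivative_eq,
      covariantDerivative_eq, hd, hv, map_add, Submodule.coe_add, add_sub_add_comm]
  leibniz g hg s X φ := by
    apply Subtype.ext
    have hd : differential (mulSection g hg s).1 X φ =
        g X • differential s.1 X φ + differential g X φ • s.1 X := by
      have h := ((hg.differentiable X 0).hasFDerivAt.smul
        (s.2.2.differentiable X 0).hasFDerivAt).fderiv
      have h' := DFunLike.congr_fun h φ
      rw [X.chart_zero] at h'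
      exact h'
    have hv : sectionValue (mulSection g hg s) X = g X • sectionValue s X := rfl
    simp only [Submodule.coe_add, Submodule.coe_smul, covariantDerivative_eq, hd, hv, map_smul,
      smul_sub]
    rw [add_sub_right_comm, add_comm]
    rfl
  smooth s X := by
    have hS : ContDiff ℝ ∞ (fderiv ℝ (fun f : X.Tangent => s.1 (X.chart f))) :=
      (s.2.2 X).fderiv_right (by simp)
    have hP : ContDiff ℝ ∞ (fun f : X.Tangent => ((X.chart f).proj).restrictScalars ℝ) :=
      (ContinuousLinearMap.restrictScalarsL ℂ H H ℝ ℝ).contDiff.comp (isSmooth_proj X)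
    -- The family B is f ↦ P(Γ_X(f)) composed with the derivative of s in the chart.
    refine ⟨_, hP.clm_comp hS, fun f φ θ h => ?_⟩
    rw [covariantDerivative_eq, ← differential_eq_proj_add,
      fderiv_chart_eq_differential s.2.2 h]
    rfl

end GrassmannCanonical

end

open GrassmannCanonical in
theorem mainTheorem6 {H : Type*} [NormedAddCommGroup H] [InnerProductSpace ℂ H] [CompleteSpace H]
    {m : ℕ} (hm : 0 < m) :
    ∃ hor : IsConnection (horizontal : ∀ X : Gr H m, X.carrier → Submodule ℝ (X.Tangent × H)),
      IsCovariantDerivative hor.covariantDerivative ∧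
      ∀ (s : smoothSections H m) (X : Gr H m) (φ : X.Tangent),
        (hor.covariantDerivative s X φ : H) = X.proj (differential s.1 X φ) ∧
        (hor.covariantDerivative s X φ : H) =
          differential s.1 X φ - (φ (sectionValue s X) : H) :=
  ⟨isConnection_horizontal, isCovariantDerivative_horizontal _, fun s X φ =>
    ⟨(covariantDerivative_eq _ s X φ).trans (differential_eq_proj_add s X φ).symm,
      covariantDerivative_eq _ s X φ⟩⟩
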